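/- Let $n\ge 0$ and let $A\subset\mathbb{Z}_{\ge 0}^n$ be finite; write $|\alpha|=\alpha_1+\dots+\alpha_n$ and $\Delta_m=\{\alpha\in\mathbb{Z}_{\ge0}^n: |\alpha|\le m\}$. Let $g_0=1$, $g_i=x_i$ and $g_{n+i}=1-x_i$ for $1\le i\le n$. For $m\in\mathbb{N}$ let $$Q_m=\mathrm{QM}_m(x_1,\dots,x_n,1-x_1,\dots,1-x_n)=\Big\{\sum_{J\subseteq[n],\,0\le i\le 2n}\sigma_{J,i}\,x^J g_i\ :\ \sigma_{J,i}\in\mathbb{R}[x_1,\dots,x_n]\text{ a sum of squares},\ \deg(\sigma_{J,i}x^Jg_i)\le m\Big\},$$ where $x^J=\prod_{j\in J}x_j$. Let $Q_m^\vee$ be the cone of linear functionals $\ell$ on $\mathbb{R}[x_1,\dots,x_n]_{\le m}$ that are nonnegative on $Q_m$, regarded as a subset of $\mathbb{R}^{\Delta_m}$ through the coordinates $(\ell(x^\gamma))_{\gamma\in\Delta_m}$. Let $\operatorname{trop}(S)=\lim_{t\to\infty}\{(\log_t|x_\gamma|)_\gamma : x\in S,\ \text{all } x_\gamma\neq 0\}$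 denote the logarithmic limit set of $S$ (the set of all points each of whose neighbourhoods meets the sets on the right for arbitrarily large $t$). For $m$ with $A\subseteq\Delta_m$ let $\pi_A:\mathbb{R}^{\Delta_m}\to\mathbb{R}^A$ be the coordinate projection. The cubical hull of $A$ is the intersection of all lattice boxes $\prod_i[l_i,u_i]\cap\mathbb{Z}^n$ with $l_i,u_i\in\mathbb{Z}_{\ge 0}$ that contain $A$; if $A\neq\emptyset$, it is the smallest such box. Then a function $h:A\to\mathbb{R}$ belongs to $\pi_A(\operatorname{trop}(Q_m^\vee))$ for all $m\in\mathbb{N}$ with $A\subseteq\Delta_m$ if and only if it extends to a function $H$ on the cubical hull $B$ of $A$ that is midpoint convex, i.e. $H(c)\le\frac12(H(a)+H(b))$ for all $a,b,c\in B$ with $a+b=2c$, and non-increasing in the coordinate directions, i.e. $H(\alpha+e_i)\le H(\alpha)$ whenever $\alpha,\alpha+e_i\in B$. In particular the tropicalized pseudo-moment cones stabilize: there is $D\in\mathbb{N}$ with $A\subseteq\Delta_D$ such that $\pi_A(\operatorname{trop}(Q_d^\vee))=\pi_A(\operatorname{trop}(Q_D^\vee))$ for all $d\ge D$. -/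

import Mathlib

open Filter Topology

noncomputable section

namespace CubePseudoMoments

/-- Exponent vectors of monomials in `n` variables, i.e. points of `ℤ_{≥ 0}ⁿ`. -/
abbrev Expo (n : ℕ) : Type := Fin n →₀ ℕ

/-- The exponent vectors of total degree at most `d`. -/
abbrev Delta (n d : ℕ) : Type := {γ : Expo n // γ.degree ≤ d}

/-- The square-free monomial `x^J` for `J ⊆ [n]`. -/
def sqfreeMonomial {n : ℕ} (J : Finset (Fin n)) : MvPolynomial (Fin n) ℝ :=
  ∏ j ∈ J, MvPolynomial.X j

/-- The list of generators `g`, preceded by `g₀ = 1` (at index `none`). -/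
def withOne {n : ℕ} {ι : Type} (g : ι → MvPolynomial (Fin n) ℝ) :
    Option ι → MvPolynomial (Fin n) ℝ
  | none => 1
  | some i => g i

/-- The truncated quadratic module `QM_d(g)`: all sums `∑_{J, i} σ_{J,i} x^J g_i`, over `J ⊆ [n]`
and over `i` in the index set of the generators together with `g₀ = 1`, where every `σ_{J,i}` is a
sum of squares of polynomials and every term has degree at most `d`. -/
def truncQM {n : ℕ} {ι : Type} [Fintype ι] (g : ι → MvPolynomial (Fin n) ℝ) (d : ℕ) :
    Set (MvPolynomial (Fin n) ℝ) :=
  {f | ∃ σ : Finset (Fin n) → Option ι → MvPolynomial (Fin n) ℝ,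
    (∀ J i, IsSumSq (σ J i)) ∧
    (∀ J i, (σ J i * sqfreeMonomial J * withOne g i).totalDegree ≤ d) ∧
    f = ∑ J, ∑ i, σ J i * sqfreeMonomial J * withOne g i}

/-- The truncated pseudo-moment cone `QM_d(g)^∨`, a cone of linear functionals on the space
`ℝ[x₁, …, xₙ]_d` of polynomials of degree at most `d`. -/
def dualCone {n : ℕ} {ι : Type} [Fintype ι] (g : ι → MvPolynomial (Fin n) ℝ) (d : ℕ) :
    Set (Module.Dual ℝ (MvPolynomial.restrictTotalDegree (Fin n) ℝ d)) :=
  {L | ∀ f : MvPolynomial.restrictTotalDegree (Fin n) ℝ d,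
    (f : MvPolynomial (Fin n) ℝ) ∈ truncQM g d → 0 ≤ L f}

/-- The monomial `x^γ` as an element of `ℝ[x₁, …, xₙ]_d`. -/
def monom {n d : ℕ} (γ : Delta n d) : MvPolynomial.restrictTotalDegree (Fin n) ℝ d :=
  ⟨MvPolynomial.monomial (γ : Expo n) 1, by
    rw [MvPolynomial.mem_restrictTotalDegree]
    refine (MvPolynomial.totalDegree_monomial_le _ _).trans ?_
    exact γ.2⟩

/-- The coordinates `(L(x^γ))_{|γ| ≤ d}` of a functional in the basis dual to the monomials. -/
def coords {n d : ℕ} (L : Module.Dual ℝ (MvPolynomial.restrictTotalDegree (Fin n) ℝ d)) :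
    Delta n d → ℝ :=
  fun γ => L (monom γ)

/-- The tropicalization of `S ⊆ ℝ^κ`, defined as its logarithmic limit set: the limit, as
`t → ∞`, of the sets `{(log_t |x_i|)_i : x ∈ S ∩ (ℝ^*)^κ}`.  A point belongs to the limit if each
of its neighbourhoods meets these sets for arbitrarily large `t`. -/
def trop {κ : Type} (S : Set (κ → ℝ)) : Set (κ → ℝ) :=
  {y | ∀ U ∈ 𝓝 y, ∃ᶠ t : ℝ in atTop,
    ∃ x ∈ S, (∀ i, x i ≠ 0) ∧ (fun i => Real.logb t |x i|) ∈ U}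

/-- The generators `x₁, …, xₙ, 1 - x₁, …, 1 - xₙ` of the cube `[0,1]ⁿ`. -/
def cubeGenerators (n : ℕ) : Fin n ⊕ Fin n → MvPolynomial (Fin n) ℝ :=
  Sum.elim (fun i => MvPolynomial.X i) (fun i => 1 - MvPolynomial.X i)

/-- `trop(Q_m^∨)` for `Q_m = QM_m(x₁, …, xₙ, 1 - x₁, …, 1 - xₙ)`. -/
def tropCubeDual (n m : ℕ) : Set (Delta n m → ℝ) :=
  trop (coords '' dualCone (cubeGenerators n) m)

/-- The coordinate projection `π_A`, defined when all elements of `A` have degree at most `d`. -/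
def projA {n d : ℕ} (A : Finset (Expo n)) (hA : ∀ a ∈ A, a.degree ≤ d) (y : Delta n d → ℝ) :
    A → ℝ :=
  fun a => y ⟨a, hA a a.2⟩

/-- The cubical hull of `A`: the intersection of all lattice boxes `∏ [lᵢ, uᵢ] ∩ ℤⁿ` with
`lᵢ, uᵢ ∈ ℤ_{≥ 0}` that contain `A`. -/
def cubicalHull {n : ℕ} (A : Finset (Expo n)) : Set (Expo n) :=
  {b | ∀ l u : Expo n, (A : Set (Expo n)) ⊆ Set.Icc l u → b ∈ Set.Icc l u}

theorem mem_cubicalHull {n : ℕ} {A : Finset (Expo n)} {a : Expo n} (ha : a ∈ A) :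
    a ∈ cubicalHull A :=
  fun _ _ h => h ha

/-- For nonempty `A` the cubical hull is itself a lattice box, the smallest one containing `A`. -/
theorem cubicalHull_isLeast {n : ℕ} {A : Finset (Expo n)} (hA : A.Nonempty) :
    IsLeast {B : Set (Expo n) | (∃ l u : Expo n, l ≤ u ∧ B = Set.Icc l u) ∧ (A : Set (Expo n)) ⊆ B}
      (cubicalHull A) := by
  refine ⟨⟨⟨A.inf' hA id, A.sup' hA id, ?_, ?_⟩, fun a ha => mem_cubicalHull ha⟩, ?_⟩
  · obtain ⟨a, ha⟩ := hA
    exact (Finset.inf'_le id ha).trans (Finset.le_sup' id ha)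
  · ext b
    constructor
    · intro hb
      exact hb _ _ fun a ha => ⟨Finset.inf'_le id ha, Finset.le_sup' id ha⟩
    · intro hb l u h
      exact ⟨(Finset.le_inf' hA id fun a ha => (h ha).1).trans hb.1,
        hb.2.trans (Finset.sup'_le hA id fun a ha => (h ha).2)⟩
  · rintro B ⟨⟨l, u, -, rfl⟩, hB⟩ b hb
    exact hb l u hB

/-- Midpoint convexity of a function on a set of lattice points. -/
def MidpointConvex {n : ℕ} {B : Set (Expo n)} (H : B → ℝ) : Prop :=
  ∀ a b c : B, (a : Expo n) + (b : Expo n) = 2 • (c : Expo n) → H c ≤ (H a + H b) / 2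

/-- `H(α + eᵢ) ≤ H(α)` whenever `α` and `α + eᵢ` are in the domain of `H`. -/
def NonincreasingInCoords {n : ℕ} {B : Set (Expo n)} (H : B → ℝ) : Prop :=
  ∀ a b : B, ∀ i : Fin n, (b : Expo n) = (a : Expo n) + Finsupp.single i 1 → H b ≤ H a

end CubePseudoMoments

end

noncomputable section

namespace CubePseudoMoments

/-! ### Sums of squares -/

/-! Necessity: if `a + b = 2c`, then `a` and `b` have the same odd part `J`, and nonnegativity on
`(r x^⌊a/2⌋ + x^⌊b/2⌋)² x^J` for all `r` gives `L(x^c)² ≤ L(x^a) L(x^b)`. Nonnegativity on `x^a (1 -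
x_i)` gives monotonicity. Logarithms turn these into weak linear inequalities, which survive the
limit. Once the hull lies in `Delta n m`, a point of the tropicalization restricts to an extension
of `h`.

Sufficiency, for every `m`: `exists_extension` extends `H` from the box to all exponents, and a
small multiple of `∑ i, 2^(-a i)` makes all inequalities strict. For the resulting `W`, the
functional `x^γ ↦ t^(W γ)` lies in the dual cone for large `t` (`powFunctional_mem_dualCone`):
strict convexity makes the scaled moment matrices diagonally dominant, and strict decrease preserves
this after localizing at `1 - x_i`.

Necessity uses a single large `m` and sufficiency works for all, hence stabilization. -/

theorem totalDegree_le_totalDegree_add {n : ℕ} {f g : MvPolynomial (Fin n) ℝ}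
    (hf : 0 ≤ MonomialOrder.degLex.leadingCoeff f) (hg : 0 ≤ MonomialOrder.degLex.leadingCoeff g) :
    f.totalDegree ≤ (f + g).totalDegree := by
  by_cases hf0 : f = 0
  · simp [hf0]
  have hpos : 0 < MonomialOrder.degLex.leadingCoeff f :=
    hf.lt_of_ne' (MonomialOrder.degLex.leadingCoeff_ne_zero_iff.2 hf0)
  rw [← MvPolynomial.degree_degLexDegree (f := f), ← MvPolynomial.degree_degLexDegree (f := f + g)]
  rcases lt_trichotomy (MonomialOrder.degLex.toSyn (MonomialOrder.degLex.degree g))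
    (MonomialOrder.degLex.toSyn (MonomialOrder.degLex.degree f)) with h | h | h
  · rw [MonomialOrder.degree_add_of_lt h]
  · have h' := MonomialOrder.degLex.toSyn.injective h
    have hmem : MonomialOrder.degLex.degree f ∈ (f + g).support := by
      rw [MvPolynomial.mem_support_iff, MvPolynomial.coeff_add]
      have h2 : 0 ≤ g.coeff (MonomialOrder.degLex.degree f) := h' ▸ hg
      exact (add_pos_of_pos_of_nonneg hpos h2).ne'
    exact Finsupp.DegLex.monotone_degree (MonomialOrder.degLex.le_degree hmem)
  · rw [MonomialOrder.degree_add_eq_right_of_lt h]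
    exact Finsupp.DegLex.monotone_degree h.le

theorem leadingCoeff_add_nonneg {n : ℕ} {f g : MvPolynomial (Fin n) ℝ}
    (hf : 0 ≤ MonomialOrder.degLex.leadingCoeff f) (hg : 0 ≤ MonomialOrder.degLex.leadingCoeff g) :
    0 ≤ MonomialOrder.degLex.leadingCoeff (f + g) := by
  rcases lt_trichotomy (MonomialOrder.degLex.toSyn (MonomialOrder.degLex.degree g))
    (MonomialOrder.degLex.toSyn (MonomialOrder.degLex.degree f)) with h | h | h
  · rwa [MonomialOrder.leadingCoeff_add_of_lt h]
  · have h' := MonomialOrder.degLex.toSyn.injective h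
    by_cases hf0 : f = 0
    · simpa [hf0] using hg
    have hpos : 0 < MonomialOrder.degLex.leadingCoeff f :=
      hf.lt_of_ne' (MonomialOrder.degLex.leadingCoeff_ne_zero_iff.2 hf0)
    have hcoeff : 0 < (f + g).coeff (MonomialOrder.degLex.degree f) := by
      rw [MvPolynomial.coeff_add]
      have h2 : 0 ≤ g.coeff (MonomialOrder.degLex.degree f) := h' ▸ hg
      exact add_pos_of_pos_of_nonneg hpos h2
    have hle := MonomialOrder.degLex.le_degree (MvPolynomial.mem_support_iff.2 hcoeff.ne')
    have hge := MonomialOrder.degLex.degree_add_le (f := f) (g := g)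
    rw [h, sup_idem] at hge
    have heq := MonomialOrder.degLex.toSyn.injective (le_antisymm hge hle)
    rw [MonomialOrder.leadingCoeff, heq]
    exact hcoeff.le
  · rw [add_comm]
    rwa [MonomialOrder.leadingCoeff_add_of_lt h]

theorem leadingCoeff_mul_self_nonneg {n : ℕ} (p : MvPolynomial (Fin n) ℝ) :
    0 ≤ MonomialOrder.degLex.leadingCoeff (p * p) := by
  rw [MonomialOrder.leadingCoeff_mul]
  exact mul_self_nonneg _

/-- Leading terms of squares cannot cancel, so a degree bound on a sum of squares passes to every
summand. -/
theorem leadingCoeff_nonneg_of_isSumSq {n : ℕ} {f : MvPolynomial (Fin n) ℝ} (hf : IsSumSq f) :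
    0 ≤ MonomialOrder.degLex.leadingCoeff f := by
  induction hf with
  | zero => simp
  | sq_add a _ ih => exact leadingCoeff_add_nonneg (leadingCoeff_mul_self_nonneg a) ih

/-- A linear functional that is nonnegative on squares of polynomials of degree at most `d` is
nonnegative on sums of squares of degree at most `d`. -/
theorem IsSumSq.map_nonneg_of_sq {n d : ℕ} (L : MvPolynomial (Fin n) ℝ →ₗ[ℝ] ℝ)
    (hL : ∀ p : MvPolynomial (Fin n) ℝ, p.totalDegree ≤ d → 0 ≤ L (p * p))
    {f : MvPolynomial (Fin n) ℝ} (hf : IsSumSq f) (hd : f.totalDegree ≤ d) : 0 ≤ L f := by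
  induction hf with
  | zero => simp
  | @sq_add a s hs ih =>
    have h1 := leadingCoeff_mul_self_nonneg a
    have h2 := leadingCoeff_nonneg_of_isSumSq hs
    have h3 := (totalDegree_le_totalDegree_add h1 h2).trans hd
    have h4 := totalDegree_le_totalDegree_add h2 h1
    rw [add_comm] at h4
    rw [map_add]
    refine add_nonneg (hL a ?_) (ih (h4.trans hd))
    by_cases ha : a = 0
    · simp [ha]
    · rw [MvPolynomial.totalDegree_mul_of_isDomain ha ha] at h3
      omega

/-- A real symmetric form with dominating diagonal is positive semidefinite. -/
theorem sum_sum_nonneg_of_dominant {ι : Type*} (S : Finset ι) (M : ι → ι → ℝ) (d p : ι → ℝ)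
    (hd : ∀ a ∈ S, 0 ≤ d a)
    (hdiag : ∀ a ∈ S, d a ^ 2 / 2 ≤ M a a)
    (hoff : ∀ a ∈ S, ∀ b ∈ S, a ≠ b → 2 * S.card * |M a b| ≤ d a * d b) :
    0 ≤ ∑ a ∈ S, ∑ b ∈ S, p a * p b * M a b := by
  classical
  rcases S.eq_empty_or_nonempty with rfl | hS
  · simp
  have hN : (0 : ℝ) < S.card := by exact_mod_cast hS.card_pos
  -- The correction is subtracted on the diagonal too, so that it sums to the full square `(∑ |p a|
  -- d a)² / (2 |S|)`, which Cauchy–Schwarz bounds.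
  have hterm : ∀ a ∈ S, ∀ b ∈ S,
      (if a = b then (|p a| * d a) ^ 2 / 2 else 0) - (|p a| * d a) * (|p b| * d b) / (2 * S.card) ≤
        p a * p b * M a b := by
    intro a ha b hb
    have hda := hd a ha
    have hdb := hd b hb
    split_ifs with hab
    · subst hab
      have h1 : p a * p a * (d a ^ 2 / 2) ≤ p a * p a * M a a :=
        mul_le_mul_of_nonneg_left (hdiag a ha) (mul_self_nonneg _)
      have h2 : (0 : ℝ) ≤ (|p a| * d a) * (|p a| * d a) / (2 * S.card) := by positivity
      have h3 : (|p a| * d a) ^ 2 / 2 = p a * p a * (d a ^ 2 / 2) := by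
        rw [mul_pow, sq_abs]; ring
      linarith
    · have h1 : |M a b| ≤ d a * d b / (2 * S.card) := by
        rw [le_div_iff₀ (by positivity)]
        linarith [hoff a ha b hb hab]
      have h2 : |p a * p b * M a b| ≤ |p a| * |p b| * (d a * d b / (2 * S.card)) := by
        rw [abs_mul, abs_mul]
        gcongr
      have h3 := neg_abs_le (p a * p b * M a b)
      have h4 : (|p a| * d a) * (|p b| * d b) / (2 * S.card) =
        |p a| * |p b| * (d a * d b / (2 * S.card)) := by ring
      linarith
  refine le_trans ?_ (Finset.sum_le_sum fun a ha => Finset.sum_le_sum fun b hb => hterm a ha b hb)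
  have hsum : ∑ a ∈ S, ∑ b ∈ S,
      ((if a = b then (|p a| * d a) ^ 2 / 2 else 0) -
        (|p a| * d a) * (|p b| * d b) / (2 * S.card)) =
      (∑ a ∈ S, (|p a| * d a) ^ 2) / 2 - (∑ a ∈ S, |p a| * d a) ^ 2 / (2 * S.card) := by
    simp only [Finset.sum_sub_distrib, ← Finset.sum_div, ← Finset.mul_sum, ← Finset.sum_mul]
    rw [sq (∑ a ∈ S, |p a| * d a)]
    congr 1
    rw [Finset.sum_div]
    exact Finset.sum_congr rfl fun a ha => by simp [ha]
  rw [hsum, sub_nonneg, div_le_div_iff₀ (by positivity) (by positivity)]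
  have := sq_sum_le_card_mul_sum_sq (s := S) (f := fun a => |p a| * d a)
  nlinarith

/-! ### Inequalities satisfied by the tropicalized pseudo-moments -/

theorem single_mem_truncQM {n d : ℕ} {ι : Type} [Fintype ι] (g : ι → MvPolynomial (Fin n) ℝ)
    {s : MvPolynomial (Fin n) ℝ} (hs : IsSumSq s) (J : Finset (Fin n)) (i : Option ι)
    (hd : (s * sqfreeMonomial J * withOne g i).totalDegree ≤ d) :
    s * sqfreeMonomial J * withOne g i ∈ truncQM g d := by
  classical
  refine ⟨fun J' i' => if J' = J ∧ i' = i then s else 0, fun J' i' => ?_, fun J' i' => ?_, ?_⟩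
  · dsimp only
    split_ifs
    exacts [hs, IsSumSq.zero]
  · dsimp only
    split_ifs with h
    · rwa [h.1, h.2]
    · simp
  · rw [Finset.sum_eq_single J, Finset.sum_eq_single i]
    · simp
    · intro i' _ h; simp [h]
    · simp
    · intro J' _ h; simp [h]
    · simp

theorem sqfreeMonomial_eq_monomial {n : ℕ} (J : Finset (Fin n)) :
    sqfreeMonomial J = MvPolynomial.monomial (∑ j ∈ J, Finsupp.single j 1) (1 : ℝ) := by
  rw [sqfreeMonomial, MvPolynomial.monomial_sum_one]
  rfl

/-- The indices of the odd entries. -/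
def oddPart {n : ℕ} (a : Expo n) : Finset (Fin n) := Finset.univ.filter fun i => a i % 2 = 1

/-- The entrywise half, rounded down. -/
def halfPart {n : ℕ} (a : Expo n) : Expo n := Finsupp.equivFunOnFinite.symm fun i => a i / 2

theorem sum_single_apply {n : ℕ} (J : Finset (Fin n)) (i : Fin n) :
    (∑ j ∈ J, Finsupp.single j 1 : Expo n) i = if i ∈ J then 1 else 0 := by
  classical
  simp [Finsupp.finsetSum_apply, Finsupp.single_apply]

theorem halfPart_add_oddPart {n : ℕ} (a : Expo n) :
    halfPart a + halfPart a + ∑ j ∈ oddPart a, Finsupp.single j 1 = a := by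
  ext i
  rw [Finsupp.add_apply, Finsupp.add_apply, sum_single_apply]
  simp only [halfPart, Finsupp.equivFunOnFinite_symm_apply_apply, oddPart, Finset.mem_filter,
    Finset.mem_univ, true_and]
  split_ifs <;> omega

theorem oddPart_eq_of_add {n : ℕ} {a b c : Expo n} (h : a + b = 2 • c) : oddPart a = oddPart b := by
  ext i
  have := DFunLike.congr_fun h i
  simp only [Finsupp.add_apply, Finsupp.smul_apply, smul_eq_mul] at this
  simp only [oddPart, Finset.mem_filter, Finset.mem_univ, true_and]
  omega

/-- This identifies the cross term of the binomial square times `x^J` as a multiple of `x^c`. -/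
theorem halfPart_add_oddPart_of_add {n : ℕ} {a b c : Expo n} (h : a + b = 2 • c) :
    halfPart a + halfPart b + ∑ j ∈ oddPart a, Finsupp.single j 1 = c := by
  ext i
  have := DFunLike.congr_fun h i
  simp only [Finsupp.add_apply, Finsupp.smul_apply, smul_eq_mul] at this
  rw [Finsupp.add_apply, Finsupp.add_apply, sum_single_apply]
  simp only [halfPart, Finsupp.equivFunOnFinite_symm_apply_apply, oddPart, Finset.mem_filter,
    Finset.mem_univ, true_and]
  split_ifs <;> omega

theorem coe_monom {n d : ℕ} (γ : Delta n d) :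
    (monom γ : MvPolynomial (Fin n) ℝ) = MvPolynomial.monomial (γ : Expo n) 1 := rfl

section

variable {n d : ℕ} {ι : Type} [Fintype ι] {g : ι → MvPolynomial (Fin n) ℝ}
  {L : Module.Dual ℝ (MvPolynomial.restrictTotalDegree (Fin n) ℝ d)}

theorem dualCone_quadratic_nonneg (hL : L ∈ dualCone g d) {a b c : Delta n d}
    (h : (a : Expo n) + b = 2 • (c : Expo n)) (r : ℝ) :
    0 ≤ coords L a * (r * r) + 2 * coords L c * r + coords L b := by
  set f : MvPolynomial.restrictTotalDegree (Fin n) ℝ d :=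
    (r * r) • monom a + (2 * r) • monom c + monom b with hf
  have hLf : L f = coords L a * (r * r) + 2 * coords L c * r + coords L b := by
    simp only [hf, map_add, map_smul, smul_eq_mul, coords]
    ring
  rw [← hLf]
  apply hL
  set p : MvPolynomial (Fin n) ℝ := MvPolynomial.monomial (halfPart (a : Expo n)) r +
    MvPolynomial.monomial (halfPart (b : Expo n)) 1 with hp
  have key : (f : MvPolynomial (Fin n) ℝ) =
      p * p * sqfreeMonomial (oddPart (a : Expo n)) * withOne g none := by
    have e1 := halfPart_add_oddPart (a : Expo n)
    have e2 := halfPart_add_oddPart (b : Expo n)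
    have e3 := halfPart_add_oddPart_of_add h
    have e4 : halfPart (b : Expo n) + halfPart (a : Expo n) +
      ∑ j ∈ oddPart (a : Expo n), Finsupp.single j 1 = (c : Expo n) := by
      rw [add_comm (halfPart (b : Expo n)), e3]
    rw [← oddPart_eq_of_add h] at e2
    rw [show withOne g none = 1 from rfl, mul_one, sqfreeMonomial_eq_monomial, hp]
    simp only [add_mul, mul_add, MvPolynomial.monomial_mul, e1, e2, e3, e4, mul_one, one_mul]
    simp only [hf, Submodule.coe_add, Submodule.coe_smul, coe_monom, MvPolynomial.smul_monomial,
      smul_eq_mul, mul_one]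
    rw [two_mul, map_add]
    abel
  -- The degree bound is automatic: `f` combines three monomials of degree at most `d`.
  have hdeg := (MvPolynomial.mem_restrictTotalDegree (Fin n) d _).1 f.2
  rw [key] at hdeg ⊢
  exact single_mem_truncQM g (IsSumSq.mul_self p) _ none hdeg

theorem dualCone_coords_nonneg (hL : L ∈ dualCone g d) (a : Delta n d) : 0 ≤ coords L a := by
  have := dualCone_quadratic_nonneg hL (a := a) (b := a) (c := a) (two_nsmul _).symm 0
  simpa using this

theorem dualCone_sq_le (hL : L ∈ dualCone g d) {a b c : Delta n d}
    (h : (a : Expo n) + b = 2 • (c : Expo n)) : coords L c ^ 2 ≤ coords L a * coords L b := by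
  have := discrim_le_zero (dualCone_quadratic_nonneg hL h)
  rw [discrim] at this
  nlinarith

end

theorem dualCone_antitone {n d : ℕ}
    {L : Module.Dual ℝ (MvPolynomial.restrictTotalDegree (Fin n) ℝ d)}
    (hL : L ∈ dualCone (cubeGenerators n) d) {a b : Delta n d} {i : Fin n}
    (h : (b : Expo n) = (a : Expo n) + Finsupp.single i 1) : coords L b ≤ coords L a := by
  rw [← sub_nonneg, coords, coords, ← map_sub]
  apply hL
  have key : ((monom a - monom b : MvPolynomial.restrictTotalDegree (Fin n) ℝ d) :
      MvPolynomial (Fin n) ℝ) =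
      MvPolynomial.monomial (halfPart (a : Expo n)) 1 * MvPolynomial.monomial (halfPart (a : Expo n)) 1 *
        sqfreeMonomial (oddPart (a : Expo n)) * withOne (cubeGenerators n) (some (Sum.inr i)) := by
    rw [sqfreeMonomial_eq_monomial]
    simp only [MvPolynomial.monomial_mul, halfPart_add_oddPart, mul_one, withOne, cubeGenerators,
      Sum.elim_inr, mul_sub, MvPolynomial.X, Submodule.coe_sub, coe_monom, h]
  have hdeg := (MvPolynomial.mem_restrictTotalDegree (Fin n) d _).1
    (monom a - monom b : MvPolynomial.restrictTotalDegree (Fin n) ℝ d).2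
  rw [key] at hdeg ⊢
  exact single_mem_truncQM _ (IsSumSq.mul_self _) _ _ hdeg

theorem trop_subset_of_isClosed {κ : Type} {S C : Set (κ → ℝ)} (hC : IsClosed C)
    (h : ∀ x ∈ S, (∀ i, x i ≠ 0) → ∀ t : ℝ, 1 < t → (fun i => Real.logb t |x i|) ∈ C) :
    trop S ⊆ C := by
  intro y hy
  by_contra hyC
  obtain ⟨t, ⟨x, hxS, hx0, hxU⟩, ht⟩ :=
    ((hy _ (hC.isOpen_compl.mem_nhds hyC)).and_eventually (eventually_gt_atTop 1)).exists
  exact hxU (h x hxS hx0 t ht)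

theorem tropCubeDual_midpoint {n m : ℕ} {y : Delta n m → ℝ} (hy : y ∈ tropCubeDual n m)
    {a b c : Delta n m} (h : (a : Expo n) + b = 2 • (c : Expo n)) : y c ≤ (y a + y b) / 2 := by
  have hC : IsClosed {y : Delta n m → ℝ | y c ≤ (y a + y b) / 2} :=
    isClosed_le (by fun_prop) (by fun_prop)
  refine trop_subset_of_isClosed hC ?_ hy
  rintro _ ⟨L, hL, rfl⟩ h0 t ht
  have hsq := dualCone_sq_le hL h
  have hlog : Real.logb t (|coords L c| ^ 2) ≤ Real.logb t (|coords L a| * |coords L b|) := by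
    refine Real.logb_le_logb_of_le ht (by have := h0 c; positivity) ?_
    rwa [sq_abs, abs_of_nonneg (dualCone_coords_nonneg hL a),
      abs_of_nonneg (dualCone_coords_nonneg hL b)]
  rw [Real.logb_mul (abs_ne_zero.2 (h0 a)) (abs_ne_zero.2 (h0 b)), Real.logb_pow] at hlog
  simp only [Set.mem_ofPred_eq]
  push_cast at hlog
  linarith

theorem tropCubeDual_antitone {n m : ℕ} {y : Delta n m → ℝ} (hy : y ∈ tropCubeDual n m)
    {a b : Delta n m} {i : Fin n} (h : (b : Expo n) = (a : Expo n) + Finsupp.single i 1) : y b ≤ y a := by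
  have hC : IsClosed {y : Delta n m → ℝ | y b ≤ y a} := isClosed_le (by fun_prop) (by fun_prop)
  refine trop_subset_of_isClosed hC ?_ hy
  rintro _ ⟨L, hL, rfl⟩ h0 t ht
  refine Real.logb_le_logb_of_le ht (abs_pos.2 (h0 b)) ?_
  rw [abs_of_nonneg (dualCone_coords_nonneg hL a), abs_of_nonneg (dualCone_coords_nonneg hL b)]
  exact dualCone_antitone hL h

/-! ### Functionals with prescribed logarithms -/

/-- The functional sending `x^γ` to `t ^ W γ`. -/
def powFunctional {n : ℕ} (W : Expo n → ℝ) (t : ℝ) : MvPolynomial (Fin n) ℝ →ₗ[ℝ] ℝ :=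
  (MvPolynomial.basisMonomials (Fin n) ℝ).constr ℝ fun γ => t ^ W γ

theorem powFunctional_monomial {n : ℕ} (W : Expo n → ℝ) (t : ℝ) (γ : Expo n) (c : ℝ) :
    powFunctional W t (MvPolynomial.monomial γ c) = c * t ^ W γ := by
  have h : MvPolynomial.monomial γ c = c • MvPolynomial.basisMonomials (Fin n) ℝ γ := by
    rw [MvPolynomial.coe_basisMonomials, MvPolynomial.smul_monomial, smul_eq_mul, mul_one]
  rw [h, map_smul, powFunctional, Module.Basis.constr_basis, smul_eq_mul]

/-- Summing over a fixed `S` instead of the support makes the matrix independent of `p`, so one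
threshold for `t` serves all `p`. -/
theorem powFunctional_mul_self_mul_monomial {n : ℕ} (W : Expo n → ℝ) (t : ℝ)
    {p : MvPolynomial (Fin n) ℝ} {S : Finset (Expo n)} (hS : p.support ⊆ S) (c : Expo n) :
    powFunctional W t (p * p * MvPolynomial.monomial c 1) =
      ∑ a ∈ S, ∑ b ∈ S, p.coeff a * p.coeff b * t ^ W (a + b + c) := by
  have hp : p = ∑ a ∈ S, MvPolynomial.monomial a (p.coeff a) := by
    conv_lhs => rw [p.as_sum]
    refine Finset.sum_subset hS fun a _ ha => ?_
    rw [MvPolynomial.notMem_support_iff.1 ha, map_zero]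
  conv_lhs => rw [hp, Finset.sum_mul_sum]
  simp only [Finset.sum_mul, map_sum, MvPolynomial.monomial_mul, mul_one,
    powFunctional_monomial]

theorem eventually_mul_rpow_le (k : ℝ) {x y : ℝ} (h : x < y) :
    ∀ᶠ t : ℝ in atTop, k * t ^ x ≤ t ^ y := by
  filter_upwards [(tendsto_rpow_atTop (sub_pos.2 h)).eventually_ge_atTop k,
    eventually_gt_atTop 0] with t ht ht0
  calc k * t ^ x ≤ t ^ (y - x) * t ^ x :=
        mul_le_mul_of_nonneg_right ht (Real.rpow_nonneg ht0.le _)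
    _ = t ^ y := by rw [← Real.rpow_add ht0, sub_add_cancel]

/-- Diagonal dominance at the scale `d a = t^(W(2a + c)/2)`. The general `v` covers both the moment
matrix and its localization at `1 - x_i`. -/
theorem sum_rpow_nonneg {n : ℕ} (W : Expo n → ℝ) {t : ℝ} (ht : 0 < t) (S : Finset (Expo n))
    (c : Expo n) (v : Expo n → ℝ)
    (hv : ∀ γ, |v γ| ≤ t ^ W γ) (hdiag : ∀ a ∈ S, t ^ W (a + a + c) / 2 ≤ v (a + a + c))
    (hoff : ∀ a ∈ S, ∀ b ∈ S, a ≠ b → 2 * S.card * t ^ W (a + b + c) ≤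
      t ^ ((W (a + a + c) + W (b + b + c)) / 2)) (p : Expo n → ℝ) :
    0 ≤ ∑ a ∈ S, ∑ b ∈ S, p a * p b * v (a + b + c) := by
  refine sum_sum_nonneg_of_dominant S (fun a b => v (a + b + c))
    (fun a => t ^ (W (a + a + c) / 2)) p (fun a _ => (Real.rpow_pos_of_pos ht _).le)
    (fun a ha => ?_) fun a ha b hb hab => ?_
  · rw [sq, ← Real.rpow_add ht, add_halves]
    exact hdiag a ha
  · rw [← Real.rpow_add ht, ← add_div]
    exact (mul_le_mul_of_nonneg_left (hv _) (by positivity)).trans (hoff a ha b hb hab)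

theorem powFunctional_nonneg {n : ℕ} (W : Expo n → ℝ)
    (hconv : ∀ a b c : Expo n, a ≠ b → a + b = 2 • c → W c < (W a + W b) / 2)
    (hanti : ∀ (a : Expo n) (i : Fin n), W (a + Finsupp.single i 1) < W a) (T : ℕ) :
    ∀ᶠ t : ℝ in atTop, ∀ p : MvPolynomial (Fin n) ℝ, p.totalDegree ≤ T →
      ∀ c : Expo n, c.degree ≤ T →
        0 ≤ powFunctional W t (p * p * MvPolynomial.monomial c 1) ∧
        ∀ i, 0 ≤ powFunctional W t (p * p * MvPolynomial.monomial c 1 *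
          (1 - MvPolynomial.X i)) := by
  set S : Finset (Expo n) := (Finsupp.finite_of_degree_le (σ := Fin n) T).toFinset with hS
  have hmem : ∀ a : Expo n, a ∈ S ↔ a.degree ≤ T := fun a => by simp [hS]
  have h1 : ∀ᶠ t : ℝ in atTop, ∀ c ∈ S, ∀ a ∈ S, ∀ b ∈ S, a ≠ b →
      2 * S.card * t ^ W (a + b + c) ≤ t ^ ((W (a + a + c) + W (b + b + c)) / 2) := by
    refine (eventually_all_finset _).2 fun c _ => (eventually_all_finset _).2 fun a _ =>
      (eventually_all_finset _).2 fun b _ => ?_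
    by_cases hab : a = b
    · simp [hab]
    · have hne : a + a + c ≠ b + b + c := fun h => hab <| by
        ext i
        have := DFunLike.congr_fun h i
        simp only [Finsupp.add_apply] at this
        omega
      -- `a + b + c` is the midpoint of `2a + c` and `2b + c`; the strict gap in exponents absorbs
      -- the constant `2 |S|`.
      filter_upwards [eventually_mul_rpow_le (2 * S.card)
        (hconv _ _ (a + b + c) hne (by rw [two_nsmul]; abel))] with t ht _ using ht
  -- The factor 2 keeps at least half of each diagonal entry after subtracting the shifted one.
  have h2 : ∀ᶠ t : ℝ in atTop, ∀ c ∈ S, ∀ a ∈ S, ∀ i : Fin n,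
      2 * t ^ W (a + a + c + Finsupp.single i 1) ≤ t ^ W (a + a + c) :=
    (eventually_all_finset _).2 fun c _ => (eventually_all_finset _).2 fun a _ =>
      eventually_all.2 fun i => eventually_mul_rpow_le 2 (hanti _ i)
  filter_upwards [h1, h2, eventually_gt_atTop 1] with t h1 h2 ht1 p hp c hc
  have ht0 : 0 < t := by linarith
  have hpS : p.support ⊆ S := fun a ha => (hmem a).2 ((MvPolynomial.le_totalDegree ha).trans hp)
  have hcS := (hmem c).2 hc
  refine ⟨?_, fun i => ?_⟩
  · rw [powFunctional_mul_self_mul_monomial W t hpS]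
    refine sum_rpow_nonneg W ht0 S c (fun γ => t ^ W γ) (fun γ => ?_) (fun a _ => ?_)
      (h1 c hcS) _
    · rw [abs_of_pos (Real.rpow_pos_of_pos ht0 _)]
    · exact half_le_self (Real.rpow_pos_of_pos ht0 _).le
  · have hX : p * p * MvPolynomial.monomial c 1 * (1 - MvPolynomial.X i) =
        p * p * MvPolynomial.monomial c 1 -
          p * p * MvPolynomial.monomial (c + Finsupp.single i 1) 1 := by
      rw [mul_sub, mul_one, MvPolynomial.X, mul_assoc (p * p) _ (MvPolynomial.monomial _ _),
        MvPolynomial.monomial_mul, mul_one]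
    rw [hX, map_sub, powFunctional_mul_self_mul_monomial W t hpS,
      powFunctional_mul_self_mul_monomial W t hpS, ← Finset.sum_sub_distrib]
    simp only [← Finset.sum_sub_distrib, ← mul_sub, ← add_assoc]
    refine sum_rpow_nonneg W ht0 S c (fun γ => t ^ W γ - t ^ W (γ + Finsupp.single i 1))
      (fun γ => ?_) (fun a ha => ?_) (h1 c hcS) _
    · have e1 := Real.rpow_pos_of_pos ht0 (W (γ + Finsupp.single i 1))
      have e2 := Real.rpow_lt_rpow_of_exponent_lt ht1 (hanti γ i)
      rw [abs_of_pos (sub_pos.2 e2)]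
      linarith
    · have := h2 c hcS a ha i
      linarith

theorem degree_sum_single_le {n : ℕ} (J : Finset (Fin n)) :
    (∑ j ∈ J, Finsupp.single j 1 : Expo n).degree ≤ n := by
  rw [map_sum]
  simpa using J.card_le_univ

theorem powFunctional_mem_dualCone {n : ℕ} (W : Expo n → ℝ)
    (hconv : ∀ a b c : Expo n, a ≠ b → a + b = 2 • c → W c < (W a + W b) / 2)
    (hanti : ∀ (a : Expo n) (i : Fin n), W (a + Finsupp.single i 1) < W a) (m : ℕ) :
    ∀ᶠ t : ℝ in atTop, (powFunctional W t).comp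
      (MvPolynomial.restrictTotalDegree (Fin n) ℝ m).subtype ∈ dualCone (cubeGenerators n) m := by
  -- One bound serves both purposes: `σ J i` has degree at most `m`, and the monomial multiplier
  -- `x^J` or `x^J x_i` at most `n + 1`.
  filter_upwards [powFunctional_nonneg W hconv hanti (m + n + 1)] with t ht
  rintro ⟨f, hf⟩ ⟨σ, hσ, hdeg, hsum⟩
  simp only [LinearMap.comp_apply, Submodule.subtype_apply]
  simp only at hsum
  rw [hsum, map_sum]
  refine Finset.sum_nonneg fun J _ => ?_
  rw [map_sum]
  refine Finset.sum_nonneg fun i _ => ?_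
  have hJ0 : sqfreeMonomial J ≠ 0 := by simp [sqfreeMonomial_eq_monomial]
  have hg0 : withOne (cubeGenerators n) i ≠ 0 := by
    rcases i with _ | i | i
    · exact one_ne_zero
    · exact MvPolynomial.X_ne_zero i
    · intro h
      have := congrArg (MvPolynomial.eval fun _ => (0 : ℝ)) h
      simp [withOne, cubeGenerators] at this
  have hσd : (σ J i).totalDegree ≤ m + n + 1 := by
    by_cases h0 : σ J i = 0
    · simp [h0]
    · have := hdeg J i
      rw [MvPolynomial.totalDegree_mul_of_isDomain (mul_ne_zero h0 hJ0) hg0,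
        MvPolynomial.totalDegree_mul_of_isDomain h0 hJ0] at this
      omega
  have hJd := degree_sum_single_le J
  rw [mul_assoc]
  refine IsSumSq.map_nonneg_of_sq
    ((powFunctional W t).comp
      (LinearMap.mulRight ℝ (sqfreeMonomial J * withOne (cubeGenerators n) i)))
    (fun p hp => ?_) (hσ J i) hσd
  simp only [LinearMap.comp_apply, LinearMap.mulRight_apply, ← mul_assoc,
    sqfreeMonomial_eq_monomial]
  rcases i with _ | i | i
  · have := (ht p hp (∑ j ∈ J, Finsupp.single j 1) (by omega)).1
    simpa [withOne] using this
  · have := (ht p hp (∑ j ∈ J, Finsupp.single j 1 + Finsupp.single i 1)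
      (by rw [map_add, Finsupp.degree_single]; omega)).1
    simpa [withOne, cubeGenerators, mul_assoc, MvPolynomial.X, MvPolynomial.monomial_mul] using this
  · exact (ht p hp (∑ j ∈ J, Finsupp.single j 1) (by omega)).2 i

theorem restrict_mem_tropCubeDual_of_strict {n : ℕ} (W : Expo n → ℝ)
    (hconv : ∀ a b c : Expo n, a ≠ b → a + b = 2 • c → W c < (W a + W b) / 2)
    (hanti : ∀ (a : Expo n) (i : Fin n), W (a + Finsupp.single i 1) < W a) (m : ℕ) :
    (fun γ : Delta n m => W γ) ∈ tropCubeDual n m := by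
  intro U hU
  refine Eventually.frequently ?_
  filter_upwards [powFunctional_mem_dualCone W hconv hanti m, eventually_gt_atTop 1] with t ht ht1
  have ht0 : 0 < t := by linarith
  have hco : ∀ γ : Delta n m, coords ((powFunctional W t).comp
      (MvPolynomial.restrictTotalDegree (Fin n) ℝ m).subtype) γ = t ^ W γ := fun γ => by
    simp [coords, coe_monom, powFunctional_monomial]
  refine ⟨_, ⟨_, ht, rfl⟩, fun γ => ?_, ?_⟩
  · rw [hco]
    exact (Real.rpow_pos_of_pos ht0 _).ne'
  · convert mem_of_mem_nhds hU using 1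
    funext γ
    rw [hco, abs_of_pos (Real.rpow_pos_of_pos ht0 _), Real.logb_rpow ht0 ht1.ne']

/-- A strictly midpoint convex function that is strictly decreasing in every coordinate. -/
def strictWeight {n : ℕ} (a : Expo n) : ℝ := ∑ i, (1 / 2 : ℝ) ^ a i

/-- AM–GM in each coordinate, strict where `a` and `b` differ. -/
theorem strictWeight_midpoint {n : ℕ} {a b c : Expo n} (hab : a ≠ b) (h : a + b = 2 • c) :
    strictWeight c < (strictWeight a + strictWeight b) / 2 := by
  have hc : ∀ i, (1 / 2 : ℝ) ^ a i * (1 / 2 : ℝ) ^ b i = ((1 / 2 : ℝ) ^ c i) ^ 2 := fun i => by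
    have := DFunLike.congr_fun h i
    simp only [Finsupp.add_apply, Finsupp.smul_apply, smul_eq_mul] at this
    rw [← pow_add, ← pow_mul, this, mul_comm]
  rw [strictWeight, strictWeight, strictWeight, ← Finset.sum_add_distrib, Finset.sum_div]
  refine Finset.sum_lt_sum (fun i _ => ?_) ?_
  · have h1 : (0 : ℝ) < (1 / 2) ^ a i := by positivity
    have h2 : (0 : ℝ) < (1 / 2) ^ b i := by positivity
    refine le_of_sq_le_sq ?_ (by positivity)
    rw [← hc i]
    nlinarith [sq_nonneg ((1 / 2 : ℝ) ^ a i - (1 / 2) ^ b i)]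
  · obtain ⟨i, hi⟩ := DFunLike.ne_iff.1 hab
    have h1 : (0 : ℝ) < (1 / 2) ^ a i := by positivity
    have h2 : (0 : ℝ) < (1 / 2) ^ b i := by positivity
    refine ⟨i, Finset.mem_univ i, lt_of_pow_lt_pow_left₀ 2 (by positivity) ?_⟩
    have hne : (1 / 2 : ℝ) ^ a i - (1 / 2) ^ b i ≠ 0 := sub_ne_zero.2 fun h =>
      hi (pow_right_injective₀ (by norm_num) (by norm_num) h)
    rw [← hc i]
    nlinarith [sq_pos_of_ne_zero hne]

theorem strictWeight_add_single {n : ℕ} (a : Expo n) (i : Fin n) :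
    strictWeight (a + Finsupp.single i 1) < strictWeight a := by
  refine Finset.sum_lt_sum (fun j _ => ?_) ⟨i, Finset.mem_univ i, ?_⟩
  · exact pow_le_pow_of_le_one (by norm_num) (by norm_num) (by simp)
  · exact pow_lt_pow_right_of_lt_one₀ (by norm_num) (by norm_num) (by simp)

/-- Midpoint convex functions on `ℤ_{≥ 0}ⁿ` that are non-increasing in the coordinate directions
restrict to points of the tropicalized pseudo-moment cones. -/
theorem restrict_mem_tropCubeDual {n : ℕ} (Y : Expo n → ℝ)
    (hconv : ∀ a b c : Expo n, a + b = 2 • c → Y c ≤ (Y a + Y b) / 2)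
    (hanti : ∀ (a : Expo n) (i : Fin n), Y (a + Finsupp.single i 1) ≤ Y a) (m : ℕ) :
    (fun γ : Delta n m => Y γ) ∈ tropCubeDual n m := by
  intro U hU
  have hlim : Tendsto (fun ε : ℝ => fun γ : Delta n m => Y γ + ε * strictWeight (γ : Expo n))
      (𝓝[>] 0) (𝓝 fun γ : Delta n m => Y γ) := by
    refine Tendsto.mono_left ?_ nhdsWithin_le_nhds
    refine tendsto_pi_nhds.2 fun γ => ?_
    have : Continuous fun ε : ℝ => Y γ + ε * strictWeight (γ : Expo n) := by fun_prop
    simpa using this.tendsto 0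
  -- `U` is also a neighbourhood of a slightly perturbed point, to which the strict case applies.
  obtain ⟨ε, hεU, hε⟩ := ((hlim.eventually (eventually_mem_nhds_iff.2 hU)).and
    self_mem_nhdsWithin).exists
  replace hε : 0 < ε := hε
  refine restrict_mem_tropCubeDual_of_strict (fun γ => Y γ + ε * strictWeight γ)
    (fun a b c hab h => ?_) (fun a i => ?_) m U hεU
  · have h1 := hconv a b c h
    have h2 := mul_lt_mul_of_pos_left (strictWeight_midpoint hab h) hε
    linarith
  · have h1 := hanti a i
    have h2 := mul_lt_mul_of_pos_left (strictWeight_add_single a i) hε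
    linarith

/-! ### Extending functions from boxes -/

theorem antitoneOn_Icc_of_add_single {n : ℕ} {l u : Expo n} {H : Expo n → ℝ}
    (hanti : ∀ a (i : Fin n), l ≤ a → a + Finsupp.single i 1 ≤ u →
      H (a + Finsupp.single i 1) ≤ H a) : AntitoneOn H (Set.Icc l u) := by
  have key : ∀ k : ℕ, ∀ d a : Expo n, d.degree = k → l ≤ a → a + d ≤ u → H (a + d) ≤ H a := by
    intro k
    induction k with
    | zero =>
      intro d a hd _ _
      rw [(Finsupp.degree_eq_zero_iff d).1 hd, add_zero]
    | succ k ih =>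
      intro d a hd hla hu
      obtain ⟨i, hi⟩ : ∃ i, d i ≠ 0 := by
        by_contra! h
        rw [show d = 0 from Finsupp.ext h, map_zero] at hd
        omega
      have hd' : d - Finsupp.single i 1 + Finsupp.single i 1 = d :=
        tsub_add_cancel_of_le (Finsupp.single_le_iff.2 (Nat.one_le_iff_ne_zero.2 hi))
      rw [← hd', ← add_assoc] at hu ⊢
      have hdeg : (d - Finsupp.single i 1).degree = k := by
        rw [← hd', map_add, Finsupp.degree_single] at hd
        omega
      exact (hanti _ i (hla.trans le_self_add) hu).trans
        (ih _ a hdeg hla (le_self_add.trans hu))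
  intro a ha b hb hab
  have := key _ (b - a) a rfl ha.1 (by rw [add_tsub_cancel_of_le hab]; exact hb.2)
  rwa [add_tsub_cancel_of_le hab] at this

/-- The coordinatewise nearest point of the box `[l, u]`. -/
def clamp {n : ℕ} (l u a : Expo n) : Expo n := (a ⊔ l) ⊓ u

theorem clamp_apply {n : ℕ} (l u a : Expo n) (i : Fin n) :
    clamp l u a i = min (max (a i) (l i)) (u i) := rfl

theorem clamp_mem {n : ℕ} {l u : Expo n} (hlu : l ≤ u) (a : Expo n) :
    clamp l u a ∈ Set.Icc l u := ⟨le_inf le_sup_right hlu, inf_le_right⟩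

theorem clamp_of_mem {n : ℕ} {l u a : Expo n} (ha : a ∈ Set.Icc l u) : clamp l u a = a := by
  rw [clamp, sup_eq_left.2 ha.1, inf_eq_left.2 ha.2]

theorem clamp_mono {n : ℕ} (l u : Expo n) : Monotone (clamp l u) := fun _ _ h =>
  inf_le_inf_right _ (sup_le_sup_right h _)

/-- The total amount by which the entries of `a` stay below those of `l`. -/
def deficit {n : ℕ} (l a : Expo n) : ℕ := ∑ i, (l i - a i)

/-- `hdef` says that no coordinate of `a` and `b` straddles `l`, so only the concave truncation at
`u` bends the segment. The clamped endpoints can then be raised within the box until their midpoint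
is `clamp l u c`, and raising them does not increase `H`. -/
theorem clamp_midpoint {n : ℕ} {l u : Expo n} (hlu : l ≤ u) {H : Expo n → ℝ}
    (hH : AntitoneOn H (Set.Icc l u))
    (hconv : ∀ a ∈ Set.Icc l u, ∀ b ∈ Set.Icc l u, ∀ c ∈ Set.Icc l u, a + b = 2 • c →
      H c ≤ (H a + H b) / 2)
    {a b c : Expo n} (h : a + b = 2 • c)
    (hdef : ∀ i, (l i - a i) + (l i - b i) = 2 * (l i - c i)) :
    H (clamp l u c) ≤ (H (clamp l u a) + H (clamp l u b)) / 2 := by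
  have hpt : ∀ i, ∃ x y : ℕ, clamp l u a i ≤ x ∧ clamp l u b i ≤ y ∧ x ≤ u i ∧ y ≤ u i ∧
      x + y = 2 * clamp l u c i := by
    intro i
    have h1 := hlu i
    have h2 := hdef i
    have h3 := DFunLike.congr_fun h i
    simp only [Finsupp.add_apply, Finsupp.smul_apply, smul_eq_mul] at h3
    simp only [clamp_apply]
    by_cases ha : min (max (a i) (l i)) (u i) ≤ min (max (c i) (l i)) (u i)
    · by_cases hb : min (max (b i) (l i)) (u i) ≤ min (max (c i) (l i)) (u i)
      · exact ⟨_, _, ha, hb, min_le_right _ _, min_le_right _ _, by ring⟩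
      · exact ⟨2 * min (max (c i) (l i)) (u i) - min (max (b i) (l i)) (u i), _, by omega, le_rfl,
          by omega, min_le_right _ _, by omega⟩
    · exact ⟨_, 2 * min (max (c i) (l i)) (u i) - min (max (a i) (l i)) (u i), le_rfl, by omega,
        min_le_right _ _, by omega, by omega⟩
  choose x y hx hy hxu hyu hxy using hpt
  have ha := clamp_mem hlu a
  have hb := clamp_mem hlu b
  have hX : clamp l u a ≤ Finsupp.equivFunOnFinite.symm x := hx
  have hY : clamp l u b ≤ Finsupp.equivFunOnFinite.symm y := hy
  have hXm : Finsupp.equivFunOnFinite.symm x ∈ Set.Icc l u := ⟨ha.1.trans hX, hxu⟩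
  have hYm : Finsupp.equivFunOnFinite.symm y ∈ Set.Icc l u := ⟨hb.1.trans hY, hyu⟩
  have h1 := hconv _ hXm _ hYm _ (clamp_mem hlu c) (by ext i; exact hxy i)
  have h2 := hH ha hXm hX
  have h3 := hH hb hYm hY
  linarith

/-- A midpoint convex function on a box that is non-increasing in the coordinate directions extends
to such a function on `ℤ_{≥ 0}ⁿ`. -/
theorem exists_extension {n : ℕ} {l u : Expo n} (hlu : l ≤ u) {H : Expo n → ℝ}
    (hconv : ∀ a ∈ Set.Icc l u, ∀ b ∈ Set.Icc l u, ∀ c ∈ Set.Icc l u, a + b = 2 • c →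
      H c ≤ (H a + H b) / 2)
    (hanti : ∀ a (i : Fin n), l ≤ a → a + Finsupp.single i 1 ≤ u →
      H (a + Finsupp.single i 1) ≤ H a) :
    ∃ Y : Expo n → ℝ, (∀ a ∈ Set.Icc l u, Y a = H a) ∧
      (∀ a b c : Expo n, a + b = 2 • c → Y c ≤ (Y a + Y b) / 2) ∧
      ∀ (a : Expo n) (i : Fin n), Y (a + Finsupp.single i 1) ≤ Y a := by
  have hH := antitoneOn_Icc_of_add_single hanti
  have hle : ∀ a ∈ Set.Icc l u, H a ≤ H l := fun a ha => hH ⟨le_rfl, hlu⟩ ha ha.1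
  have hge : ∀ a ∈ Set.Icc l u, H u ≤ H a := fun a ha => hH ha ⟨hlu, le_rfl⟩ ha.2
  have hK : 0 ≤ 2 * (H l - H u) := by linarith [hle u ⟨hlu, le_rfl⟩]
  -- If a coordinate straddles `l`, the integer `deficit l a + deficit l b` exceeds `2 * deficit l
  -- c` by at least 1. With this slope the averaged penalty gains at least `H l - H u`, the
  -- oscillation of `H` on the box.
  refine ⟨fun a => H (clamp l u a) + 2 * (H l - H u) * deficit l a, fun a ha => ?_,
    fun a b c h => ?_, fun a i => ?_⟩
  · have : deficit l a = 0 := Finset.sum_eq_zero fun i _ => Nat.sub_eq_zero_of_le (ha.1 i)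
    simp [clamp_of_mem ha, this]
  · have hpt : ∀ i, 2 * (l i - c i) ≤ (l i - a i) + (l i - b i) := fun i => by
      have := DFunLike.congr_fun h i
      simp only [Finsupp.add_apply, Finsupp.smul_apply, smul_eq_mul] at this
      omega
    have hle2 : 2 * deficit l c ≤ deficit l a + deficit l b := by
      rw [deficit, deficit, deficit, Finset.mul_sum, ← Finset.sum_add_distrib]
      exact Finset.sum_le_sum fun i _ => hpt i
    by_cases hdef : ∀ i, (l i - a i) + (l i - b i) = 2 * (l i - c i)
    · have h1 := clamp_midpoint hlu hH hconv h hdef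
      have h2 : (2 * deficit l c : ℝ) ≤ deficit l a + deficit l b := by exact_mod_cast hle2
      nlinarith
    · push Not at hdef
      obtain ⟨i, hi⟩ := hdef
      have hlt : 2 * deficit l c + 1 ≤ deficit l a + deficit l b := by
        rw [deficit, deficit, deficit, Finset.mul_sum, ← Finset.sum_add_distrib]
        exact Finset.sum_lt_sum (fun i _ => hpt i) ⟨i, Finset.mem_univ i, (hpt i).lt_of_ne' hi⟩
      have h2 : (2 * deficit l c + 1 : ℝ) ≤ deficit l a + deficit l b := by exact_mod_cast hlt
      have h3 := hle _ (clamp_mem hlu c)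
      have h4 := hge _ (clamp_mem hlu a)
      have h5 := hge _ (clamp_mem hlu b)
      nlinarith
  · have h1 : deficit l (a + Finsupp.single i 1) ≤ deficit l a :=
      Finset.sum_le_sum fun j _ => Nat.sub_le_sub_left (by simp) _
    have h2 : (deficit l (a + Finsupp.single i 1) : ℝ) ≤ deficit l a := by exact_mod_cast h1
    exact add_le_add (hH (clamp_mem hlu _) (clamp_mem hlu _) (clamp_mono l u le_self_add))
      (mul_le_mul_of_nonneg_left h2 hK)

/-! ### Projections of the tropicalized pseudo-moment cones -/

/-- `h` extends to a midpoint convex function on the cubical hull of `A` that is non-increasing in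
the coordinate directions. -/
def HasHullExtension {n : ℕ} (A : Finset (Expo n)) (h : A → ℝ) : Prop :=
  ∃ H : cubicalHull A → ℝ, (∀ a : A, H ⟨a, mem_cubicalHull a.2⟩ = h a) ∧
    MidpointConvex H ∧ NonincreasingInCoords H

theorem exists_cubicalHull_eq_Icc {n : ℕ} {A : Finset (Expo n)} (hA : A.Nonempty) :
    ∃ l u : Expo n, l ≤ u ∧ cubicalHull A = Set.Icc l u := (cubicalHull_isLeast hA).1.1

theorem HasHullExtension.mem_image {n : ℕ} {A : Finset (Expo n)} {h : A → ℝ}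
    (hh : HasHullExtension A h) {m : ℕ} (hm : ∀ a ∈ A, a.degree ≤ m) :
    h ∈ projA A hm '' tropCubeDual n m := by
  classical
  rcases A.eq_empty_or_nonempty with rfl | hA
  · refine ⟨_, restrict_mem_tropCubeDual (fun _ => 0) (fun _ _ _ _ => by simp)
      (fun _ _ => le_rfl) m, ?_⟩
    funext a
    exact absurd a.2 (Finset.notMem_empty _)
  obtain ⟨H, hHh, hconv, hanti⟩ := hh
  obtain ⟨l, u, hlu, hB⟩ := exists_cubicalHull_eq_Icc hA
  -- The value 0 is immaterial: `F` is only evaluated on the hull.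
  set F : Expo n → ℝ := fun a => if ha : a ∈ cubicalHull A then H ⟨a, ha⟩ else 0 with hF
  have hFH : ∀ a (ha : a ∈ cubicalHull A), F a = H ⟨a, ha⟩ := fun a ha => dif_pos ha
  obtain ⟨Y, hY, hY1, hY2⟩ := exists_extension (H := F) hlu
    (fun a ha b hb c hc habc => by
      rw [← hB] at ha hb hc
      rw [hFH a ha, hFH b hb, hFH c hc]
      exact hconv ⟨a, ha⟩ ⟨b, hb⟩ ⟨c, hc⟩ habc)
    (fun a i hla hu => by
      have ha : a ∈ cubicalHull A := hB ▸ ⟨hla, le_self_add.trans hu⟩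
      have hb : a + Finsupp.single i 1 ∈ cubicalHull A := hB ▸ ⟨hla.trans le_self_add, hu⟩
      rw [hFH a ha, hFH _ hb]
      exact hanti ⟨a, ha⟩ ⟨_, hb⟩ i rfl)
  refine ⟨_, restrict_mem_tropCubeDual Y hY1 hY2 m, ?_⟩
  funext a
  have ha := mem_cubicalHull a.2
  rw [← hHh a, ← hFH _ ha]
  exact hY _ (hB ▸ ha)

theorem hasHullExtension_of_mem_image {n : ℕ} {A : Finset (Expo n)} {h : A → ℝ} {m : ℕ}
    (hm : ∀ a ∈ A, a.degree ≤ m) (hB : ∀ a ∈ cubicalHull A, a.degree ≤ m)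
    (hh : h ∈ projA A hm '' tropCubeDual n m) : HasHullExtension A h := by
  obtain ⟨y, hy, rfl⟩ := hh
  refine ⟨fun b => y ⟨b, hB b b.2⟩, fun a => rfl, fun a b c habc => ?_, fun a b i hab => ?_⟩
  · exact tropCubeDual_midpoint hy habc
  · exact tropCubeDual_antitone hy hab

theorem hasHullExtension_empty {n : ℕ} (h : (∅ : Finset (Expo n)) → ℝ) :
    HasHullExtension ∅ h :=
  ⟨fun _ => 0, fun a => absurd a.2 (Finset.notMem_empty _), fun _ _ _ _ => by simp,
    fun _ _ _ _ => le_rfl⟩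

/-- Beyond some degree, the projected cone consists of the functions extending to the hull. -/
theorem exists_forall_mem_image_iff {n : ℕ} (A : Finset (Expo n)) :
    ∃ (D : ℕ) (_ : ∀ a ∈ A, a.degree ≤ D), ∀ (d : ℕ) (hd : ∀ a ∈ A, a.degree ≤ d), D ≤ d →
      ∀ h : A → ℝ, h ∈ projA A hd '' tropCubeDual n d ↔ HasHullExtension A h := by
  rcases A.eq_empty_or_nonempty with rfl | hA
  · exact ⟨0, by simp, fun d hd _ h => ⟨fun _ => hasHullExtension_empty h, fun hh => hh.mem_image hd⟩⟩
  obtain ⟨l, u, hlu, hB⟩ := exists_cubicalHull_eq_Icc hA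
  -- The top corner `u` has the largest degree in the box, so `D = u.degree` puts the whole hull in
  -- range.
  have hdeg : ∀ a ∈ cubicalHull A, a.degree ≤ u.degree := fun a ha =>
    Finsupp.degree_mono (hB ▸ ha : a ∈ Set.Icc l u).2
  exact ⟨u.degree, fun a ha => hdeg a (mem_cubicalHull ha), fun d hd hD h =>
    ⟨hasHullExtension_of_mem_image hd fun a ha => (hdeg a ha).trans hD, fun hh => hh.mem_image hd⟩⟩

end CubePseudoMoments

end

theorem mainTheorem5 (n : ℕ) (A : Finset (CubePseudoMoments.Expo n)) :
    (∀ h : A → ℝ,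
      (∀ (m : ℕ) (hm : ∀ a ∈ A, a.degree ≤ m),
        h ∈ CubePseudoMoments.projA A hm '' CubePseudoMoments.tropCubeDual n m) ↔
      ∃ H : CubePseudoMoments.cubicalHull A → ℝ,
        (∀ a : A, H ⟨a, CubePseudoMoments.mem_cubicalHull a.2⟩ = h a) ∧
        CubePseudoMoments.MidpointConvex H ∧
        CubePseudoMoments.NonincreasingInCoords H) ∧
    (∃ (D : ℕ) (hD : ∀ a ∈ A, a.degree ≤ D), ∀ (d : ℕ) (hd : D ≤ d),
      CubePseudoMoments.projA A (fun a ha => (hD a ha).trans hd) ''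
          CubePseudoMoments.tropCubeDual n d =
        CubePseudoMoments.projA A hD '' CubePseudoMoments.tropCubeDual n D) := by
  obtain ⟨D, hD, hiff⟩ := CubePseudoMoments.exists_forall_mem_image_iff A
  refine ⟨fun h => ⟨fun hh => (hiff D hD le_rfl h).1 (hh D hD), fun hh m hm =>
    CubePseudoMoments.HasHullExtension.mem_image hh hm⟩, D, hD, fun d hd => ?_⟩
  ext h
  rw [hiff d _ hd, hiff D _ le_rfl]
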